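/- All graphs are finite and simple. A map $f : V(G) \to \{1,\dots,k\}$ (not necessarily a proper colouring) \emph{distinguishes} $G$ if for every nontrivial automorphism $\phi$ of $G$ there is a vertex $v$ with $f(v) \neq f(\phi(v))$. The \emph{distinguishing number} $D(G)$ is the least $k$ for which some map $f : V(G) \to \{1,\dots,k\}$ distinguishes $G$, and a distinguishing map $f : V(G) \to \{1,\dots,k\}$ is \emph{optimal} if $k = D(G)$. The line graph $L(G)$ has the edges of $G$ as its vertices, two distinct edges being adjacent if they share an endpoint. The center of a connected graph is the set of its vertices of minimum eccentricity. Let $T$ be a finite tree with at least two vertices. If $T$ has an optimal distinguishing colouring that is constant on the center of $T$, then $D(T) = D(L(T))$. -/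

import Mathlib

namespace SimpleGraph

/-- A colouring `f` of the vertices (not required to be proper) distinguishes `G`, that is, it is
symmetry-breaking, if every nontrivial automorphism of `G` moves some vertex to a vertex of a
different colour. -/
def IsDistinguishing {V α : Type*} (G : SimpleGraph V) (f : V → α) : Prop :=
  ∀ φ : G ≃g G, φ ≠ Iso.refl → ∃ v : V, f v ≠ f (φ v)

/-- The distinguishing number: the least `k` such that some map from the vertices to a set of
`k` colours distinguishes `G`. (For a finite graph an injective colouring shows that such a `k`
exists.) -/
noncomputable def distinguishingNumber {V : Type*} (G : SimpleGraph V) : ℕ :=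
  sInf {k : ℕ | ∃ f : V → Fin k, G.IsDistinguishing f}

/-- A distinguishing colouring with `k` available colours is optimal if `k` is the
distinguishing number of the graph. -/
def IsOptimalDistinguishing {V : Type*} (G : SimpleGraph V) {k : ℕ} (f : V → Fin k) : Prop :=
  G.IsDistinguishing f ∧ k = G.distinguishingNumber

end SimpleGraph

namespace SimpleGraph

/-! ### Distances in trees -/

variable {V : Type*} {G : SimpleGraph V}

/-! A tree has no triangles, so every automorphism of its line graph is induced by one of the tree
(`Connected.exists_iso_of_lineGraph_iso`), and colourings of vertices and edges can be traded. A
noncentral vertex has exactly one neighbour of no larger eccentricity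
(`IsTree.exists_adj_natEccent_lt`, `IsTree.eq_of_adj_of_natEccent_le`). The edge to it pairs
noncentral vertices with edges, compatibly with automorphisms; only an edge joining two central
vertices is left out. Colours move along this pairing. Nothing is lost at the center: automorphisms
preserve it, so a colouring constant there detects no motion of central vertices, and an edge inside
it is fixed by all of them. The hypothesis also excludes the one-edge tree, whose swap acts
trivially on edges. -/

lemma IsAcyclic.length_eq_dist (hG : G.IsAcyclic) {u v : V} {p : G.Walk u v} (hp : p.IsPath) :
    p.length = G.dist u v := by
  obtain ⟨q, hq, hq'⟩ := p.reachable.exists_path_of_dist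
  have : (⟨p, hp⟩ : G.Path u v) = ⟨q, hq⟩ := (hG.subsingleton_path _ _).elim _ _
  rw [← hq', Subtype.mk.inj this]

/-- In a tree, distances add up across an edge that separates two vertices. -/
lemma IsTree.dist_add_of_adj (hG : G.IsTree) {c w v x : V} (hwv : G.Adj w v)
    (hc : G.dist c v = G.dist c w + 1) (hx : G.dist w x = G.dist v x + 1) :
    G.dist c x = G.dist c w + (G.dist v x + 1) := by
  obtain ⟨p, -, hpl⟩ := hG.connected.exists_path_of_dist c w
  obtain ⟨q, -, hql⟩ := hG.connected.exists_path_of_dist v x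
  have h1 : (p.concat hwv).IsPath := Walk.isPath_of_length_eq_dist _ (by simp [hpl, hc])
  have h2 : (Walk.cons hwv q).IsPath := Walk.isPath_of_length_eq_dist _ (by simp [hql, hx])
  have h3 : (p.append (Walk.cons hwv q)).IsPath := by
    rw [hG.isAcyclic.isPath_iff_isChain] at h1 h2 ⊢
    rw [Walk.edges_concat, List.concat_eq_append] at h1
    rw [Walk.edges_cons] at h2
    rw [Walk.edges_append, Walk.edges_cons]
    exact List.isChain_split.2 ⟨h1, h2⟩
  rw [← hG.isAcyclic.length_eq_dist h3]
  simp [hpl, hql]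

/-- In a tree, at most one neighbour of a vertex is closer to a given vertex. -/
lemma IsTree.eq_of_adj_of_dist_lt (hG : G.IsTree) {x v u u' : V} (hu : G.Adj v u)
    (hu' : G.Adj v u') (h : G.dist v x = G.dist u x + 1) (h' : G.dist v x = G.dist u' x + 1) :
    u = u' := by
  obtain ⟨p, -, hpl⟩ := hG.connected.exists_path_of_dist u x
  obtain ⟨q, -, hql⟩ := hG.connected.exists_path_of_dist u' x
  have h1 : (Walk.cons hu p).IsPath := Walk.isPath_of_length_eq_dist _ (by simp [hpl, h])
  have h2 : (Walk.cons hu' q).IsPath := Walk.isPath_of_length_eq_dist _ (by simp [hql, h'])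
  have : (⟨_, h1⟩ : G.Path v x) = ⟨_, h2⟩ := (hG.isAcyclic.subsingleton_path _ _).elim _ _
  simpa using congrArg Walk.snd (Subtype.mk.inj this)

lemma IsTree.dist_left_eq_add_one_of_adj (hG : G.IsTree) (x : V) {v w : V} (h : G.Adj v w) :
    G.dist v x = G.dist w x + 1 ∨ G.dist w x = G.dist v x + 1 := by
  simpa only [dist_comm] using hG.dist_eq_dist_add_one_of_adj x h

lemma IsTree.not_adj_of_adj_of_adj (hG : G.IsTree) {a b c : V} (hab : G.Adj a b)
    (hac : G.Adj a c) : ¬ G.Adj b c := fun hbc =>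
  hG.dist_ne_of_adj a hbc (by rw [dist_eq_one_iff_adj.2 hab, dist_eq_one_iff_adj.2 hac])

/-- Connected vertices at positive distance: the first step of a shortest walk. -/
lemma Connected.exists_adj_dist_eq (hG : G.Connected) {v c : V} (h : v ≠ c) :
    ∃ w, G.Adj v w ∧ G.dist v c = G.dist w c + 1 := by
  obtain ⟨p, -, hp⟩ := hG.exists_path_of_dist v c
  cases p with
  | nil => exact absurd rfl h
  | cons hvw q =>
    refine ⟨_, hvw, ?_⟩
    have h1 := dist_le q
    have h3 := dist_eq_one_iff_adj.2 hvw
    rename_i w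
    have h2 := hG.dist_triangle (u := v) (v := w) (w := c)
    rw [Walk.length_cons] at hp
    omega

lemma Iso.dist_le (hG : G.Connected) (φ : G ≃g G) (u v : V) :
    G.dist (φ u) (φ v) ≤ G.dist u v := by
  obtain ⟨p, hp⟩ := hG.exists_walk_length_eq_dist u v
  rw [← hp, ← Walk.length_map φ.toHom p]
  exact SimpleGraph.dist_le (p.map φ.toHom)

/-- The eccentricity as a natural number. -/
noncomputable def natEccent (G : SimpleGraph V) (v : V) : ℕ := (G.eccent v).toNat

/-! ### Eccentricity and the center of a tree -/

section natEccent

variable [Finite V]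

lemma Connected.coe_natEccent (hG : G.Connected) (v : V) : (G.natEccent v : ℕ∞) = G.eccent v := by
  obtain ⟨x, hx⟩ := G.exists_edist_eq_eccent_of_finite v
  rw [natEccent, ← hx, ← (hG v x).coe_dist_eq_edist, ENat.toNat_natCast]

lemma Connected.dist_le_natEccent (hG : G.Connected) (v x : V) : G.dist v x ≤ G.natEccent v := by
  rw [← Nat.cast_le (α := ℕ∞), hG.coe_natEccent, (hG v x).coe_dist_eq_edist]
  exact edist_le_eccent

lemma Connected.exists_dist_eq_natEccent (hG : G.Connected) (v : V) :
    ∃ x, G.dist v x = G.natEccent v := by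
  obtain ⟨x, hx⟩ := G.exists_edist_eq_eccent_of_finite v
  refine ⟨x, ?_⟩
  rw [natEccent, ← hx, ← (hG v x).coe_dist_eq_edist, ENat.toNat_natCast]

lemma Connected.mem_center_iff_natEccent (hG : G.Connected) {c : V} :
    c ∈ G.center ↔ ∀ v, G.natEccent c ≤ G.natEccent v := by
  have key : c ∈ G.center ↔ ∀ v, G.eccent c ≤ G.eccent v := by
    rw [mem_center_iff, radius]
    exact ⟨fun h v => h ▸ iInf_le _ v, fun h => le_antisymm (le_iInf h) (iInf_le _ c)⟩
  simp only [key, ← hG.coe_natEccent, Nat.cast_le]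

lemma Iso.natEccent_apply (hG : G.Connected) (φ : G ≃g G) (v : V) :
    G.natEccent (φ v) = G.natEccent v := by
  have key : ∀ (φ : G ≃g G) (v : V), G.natEccent (φ v) ≤ G.natEccent v := fun φ v => by
    obtain ⟨x, hx⟩ := hG.exists_dist_eq_natEccent (φ v)
    calc G.natEccent (φ v) = G.dist (φ v) (φ (φ.symm x)) := by simp [hx]
      _ ≤ G.dist v (φ.symm x) := φ.dist_le hG _ _
      _ ≤ _ := hG.dist_le_natEccent _ _
  refine le_antisymm (key φ v) ?_
  simpa using key φ.symm (φ v)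

lemma Iso.apply_mem_center_iff (hG : G.Connected) (φ : G ≃g G) {v : V} :
    φ v ∈ G.center ↔ v ∈ G.center := by
  simp only [hG.mem_center_iff_natEccent, φ.natEccent_apply hG]

/-- Stepping from `v` towards a vertex `c` of no larger eccentricity decreases the eccentricity,
unless the step ends in `c` and the eccentricities agree. -/
lemma IsTree.natEccent_lt_of_adj (hG : G.IsTree) {c v w : V} (hvw : G.Adj v w)
    (hd : G.dist v c = G.dist w c + 1) (hc : G.natEccent c ≤ G.natEccent v)
    (h : w ≠ c ∨ G.natEccent c < G.natEccent v) : G.natEccent w < G.natEccent v := by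
  obtain ⟨x, hx⟩ := hG.connected.exists_dist_eq_natEccent w
  rw [← hx]
  have hv := hG.connected.dist_le_natEccent v x
  rcases hG.dist_left_eq_add_one_of_adj x hvw with h1 | h1
  · omega
  -- Here the path from `c` to `x` runs through `w` and then `v`, so the eccentricity of `c` is at
  -- least that of `w` plus `dist c w`.
  · have h2 := hG.dist_add_of_adj (c := c) hvw.symm (by rw [dist_comm, hd, dist_comm]) h1
    have h3 := hG.connected.dist_le_natEccent c x
    rcases h with h | h
    · have h4 := hG.connected.pos_dist_of_ne h.symm
      omega
    · omega

lemma IsTree.exists_adj_natEccent_lt (hG : G.IsTree) {v : V} (hv : v ∉ G.center) :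
    ∃ w, G.Adj v w ∧ G.natEccent w < G.natEccent v := by
  have := hG.connected.nonempty
  obtain ⟨c, hc⟩ := Finite.exists_min G.natEccent
  have hcv : G.natEccent c < G.natEccent v := by
    by_contra! h
    exact hv (hG.connected.mem_center_iff_natEccent.2 fun x => h.trans (hc x))
  have hne : v ≠ c := by rintro rfl; exact lt_irrefl _ hcv
  obtain ⟨w, hvw, hw⟩ := hG.connected.exists_adj_dist_eq hne
  exact ⟨w, hvw, hG.natEccent_lt_of_adj hvw hw hcv.le (.inr hcv)⟩

/-- Fix a vertex `x` farthest from `v`. A neighbour farther from `x` than `v` would have larger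
eccentricity, so both neighbours are closer to `x`, and only one neighbour can be. -/
lemma IsTree.eq_of_adj_of_natEccent_le (hG : G.IsTree) {v u u' : V} (hu : G.Adj v u)
    (hu' : G.Adj v u') (h : G.natEccent u ≤ G.natEccent v) (h' : G.natEccent u' ≤ G.natEccent v) :
    u = u' := by
  obtain ⟨x, hx⟩ := hG.connected.exists_dist_eq_natEccent v
  have h1 := hG.connected.dist_le_natEccent u x
  have h2 := hG.connected.dist_le_natEccent u' x
  have h3 := hG.dist_left_eq_add_one_of_adj x hu
  have h4 := hG.dist_left_eq_add_one_of_adj x hu'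
  exact hG.eq_of_adj_of_dist_lt hu hu' (x := x) (by omega) (by omega)

/-- Otherwise the first step from `c` towards `c'` would reach a vertex of eccentricity below the
minimum. -/
lemma IsTree.eq_or_adj_of_mem_center (hG : G.IsTree) {c c' : V} (hc : c ∈ G.center)
    (hc' : c' ∈ G.center) : c = c' ∨ G.Adj c c' := by
  rw [hG.connected.mem_center_iff_natEccent] at hc hc'
  rw [or_iff_not_imp_left]
  intro hne
  obtain ⟨w, hvw, hw⟩ := hG.connected.exists_adj_dist_eq hne
  by_cases hwc : w = c'
  · exact hwc ▸ hvw
  · exact absurd (hG.natEccent_lt_of_adj hvw hw (hc' c) (.inl hwc)) (hc w).not_gt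

/-- The centre of a tree is contained in any edge joining two central vertices. -/
lemma IsTree.eq_or_eq_of_mem_center (hG : G.IsTree) {u v w : V} (huv : G.Adj u v)
    (hu : u ∈ G.center) (hv : v ∈ G.center) (hw : w ∈ G.center) : w = u ∨ w = v := by
  rcases hG.eq_or_adj_of_mem_center hu hw with h | h
  · exact .inl h.symm
  · rw [hG.connected.mem_center_iff_natEccent] at hv hw
    exact .inr (hG.eq_of_adj_of_natEccent_le h huv (hw u) (hv u))

/-- The endpoints of an edge whose endpoints have equal eccentricity are central. -/
lemma IsTree.mem_center_of_adj_of_natEccent_eq (hG : G.IsTree) {u v : V} (huv : G.Adj u v)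
    (h : G.natEccent u = G.natEccent v) : u ∈ G.center := by
  by_contra hu
  obtain ⟨w, hw, hlt⟩ := hG.exists_adj_natEccent_lt hu
  have := hG.eq_of_adj_of_natEccent_le hw huv hlt.le h.ge
  subst this
  omega

end natEccent

/-! ### Automorphisms of line graphs of triangle-free graphs -/

section Whitney

/-- In a connected graph, an edge that meets no other edge is the only edge. -/
lemma Connected.edgeSet_subsingleton_of_isolated (hG : G.Connected) {u v : V} {e : G.edgeSet}
    (he : (e : Sym2 V) = s(u, v)) (hu : ∀ f : G.edgeSet, u ∈ (f : Sym2 V) → f = e)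
    (hv : ∀ f : G.edgeSet, v ∈ (f : Sym2 V) → f = e) (f : G.edgeSet) : f = e := by
  have key : ∀ x, x = u ∨ x = v := by
    intro x
    by_contra hx
    obtain ⟨p⟩ := hG u x
    obtain ⟨d, -, h1, h2⟩ := p.exists_boundary_dart {y | y = u ∨ y = v} (.inl rfl) hx
    have hd : (⟨d.edge, d.edge_mem⟩ : G.edgeSet) = e := by
      rcases h1 with h1 | h1
      · exact hu _ (by simp [Dart.edge, ← h1])
      · exact hv _ (by simp [Dart.edge, ← h1])
    have h3 : d.snd ∈ (e : Sym2 V) := by rw [← hd]; simp [Dart.edge]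
    rw [he, Sym2.mem_iff] at h3
    exact h2 h3
  obtain ⟨⟨a, b⟩, hf⟩ := f
  rcases key a with h | h
  · exact hu _ (by simp [← h])
  · exact hv _ (by simp [← h])

lemma Connected.exists_edge_mem [Nontrivial V] (hG : G.Connected) (v : V) :
    ∃ e : G.edgeSet, v ∈ (e : Sym2 V) := by
  obtain ⟨w, hw⟩ := exists_ne v
  obtain ⟨u, hu, -⟩ := hG.exists_adj_dist_eq hw.symm
  exact ⟨⟨s(v, u), hu⟩, by simp⟩

/-- An automorphism of the line graph of a triangle-free graph maps edges with a common endpoint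
to edges with a common endpoint. -/
lemma mem_lineGraph_apply_of_mem (htri : ∀ ⦃a b c : V⦄, G.Adj a b → G.Adj a c → ¬ G.Adj b c)
    (ψ : G.lineGraph ≃g G.lineGraph) {e f g : G.edgeSet} (hef : e ≠ f) {v w : V}
    (he : v ∈ (e : Sym2 V)) (hf : v ∈ (f : Sym2 V)) (hg : v ∈ (g : Sym2 V))
    (hwe : w ∈ (ψ e : Sym2 V)) (hwf : w ∈ (ψ f : Sym2 V)) : w ∈ (ψ g : Sym2 V) := by
  by_contra hw
  have hge : g ≠ e := by rintro rfl; exact hw hwe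
  have hgf : g ≠ f := by rintro rfl; exact hw hwf
  obtain ⟨-, a, hag, hae⟩ := lineGraph_adj_iff_exists.1
    (ψ.map_adj_iff.2 (lineGraph_adj_iff_exists.2 ⟨hge, v, hg, he⟩))
  obtain ⟨-, b, hbg, hbf⟩ := lineGraph_adj_iff_exists.1
    (ψ.map_adj_iff.2 (lineGraph_adj_iff_exists.2 ⟨hgf, v, hg, hf⟩))
  have hwa : w ≠ a := by rintro rfl; exact hw hag
  have hwb : w ≠ b := by rintro rfl; exact hw hbg
  -- The images of `e`, `f`, `g` are the edges `wa`, `wb`, `ab`, which form a triangle.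
  have h1 := (Sym2.mem_and_mem_iff hwa).1 ⟨hwe, hae⟩
  have h2 := (Sym2.mem_and_mem_iff hwb).1 ⟨hwf, hbf⟩
  have hab : a ≠ b := by
    rintro rfl
    exact hef (ψ.injective (Subtype.ext (h1.trans h2.symm)))
  have h3 := (Sym2.mem_and_mem_iff hab).1 ⟨hag, hbg⟩
  have k1 := (ψ e).2
  have k2 := (ψ f).2
  have k3 := (ψ g).2
  rw [h1, mem_edgeSet] at k1
  rw [h2, mem_edgeSet] at k2
  rw [h3, mem_edgeSet] at k3
  exact htri k1 k2 k3

/-- Two edges at `v` already determine `w`; using the preceding lemma for both `ψ` and its inverse,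
the star at `v` goes exactly onto the star at `w`. -/
lemma exists_forall_mem_iff_mem_lineGraph_apply
    (htri : ∀ ⦃a b c : V⦄, G.Adj a b → G.Adj a c → ¬ G.Adj b c)
    (ψ : G.lineGraph ≃g G.lineGraph) {e f : G.edgeSet} (hef : e ≠ f) {v : V}
    (he : v ∈ (e : Sym2 V)) (hf : v ∈ (f : Sym2 V)) :
    ∃ w, ∀ g : G.edgeSet, v ∈ (g : Sym2 V) ↔ w ∈ (ψ g : Sym2 V) := by
  obtain ⟨-, w, hwe, hwf⟩ := lineGraph_adj_iff_exists.1
    (ψ.map_adj_iff.2 (lineGraph_adj_iff_exists.2 ⟨hef, v, he, hf⟩))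
  refine ⟨w, fun g => ⟨fun hg => mem_lineGraph_apply_of_mem htri ψ hef he hf hg hwe hwf,
    fun hg => ?_⟩⟩
  have := mem_lineGraph_apply_of_mem htri ψ.symm (ψ.injective.ne hef) hwe hwf hg (w := v)
    (by simpa using he) (by simpa using hf)
  simpa using this

/-- Every automorphism of the line graph of a finite connected triangle-free graph is induced by
an automorphism of the graph. -/
theorem Connected.exists_iso_of_lineGraph_iso [Finite V] [Nontrivial V] (hG : G.Connected)
    (htri : ∀ ⦃a b c : V⦄, G.Adj a b → G.Adj a c → ¬ G.Adj b c)
    (ψ : G.lineGraph ≃g G.lineGraph) : ∃ φ : G ≃g G, φ.lineGraph = ψ := by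
  by_cases hsub : Subsingleton G.edgeSet
  · exact ⟨Iso.refl, RelIso.ext fun e => Subsingleton.elim _ _⟩
  have hnot : ∀ e : G.edgeSet, ¬ ∀ f, f = e := fun e h =>
    hsub ⟨fun a b => (h a).trans (h b).symm⟩
  have hex : ∀ v, ∃ w, ∀ g : G.edgeSet, v ∈ (g : Sym2 V) ↔ w ∈ (ψ g : Sym2 V) := by
    intro v
    obtain ⟨e, hve⟩ := hG.exists_edge_mem v
    -- If `v` is a leaf on the edge `e = uv`, then `u` has another edge, hence an image `w`, and `v`
    -- must go to the other end of `ψ e`.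
    by_cases hv : ∀ f : G.edgeSet, v ∈ (f : Sym2 V) → f = e
    · obtain ⟨u, heu⟩ := id hve
      have hu : ¬ ∀ f : G.edgeSet, u ∈ (f : Sym2 V) → f = e := fun hu =>
        hnot e (hG.edgeSet_subsingleton_of_isolated heu hv hu)
      push Not at hu
      obtain ⟨f, huf, hfe⟩ := hu
      have hue : u ∈ (e : Sym2 V) := by rw [heu]; simp
      obtain ⟨w, hw⟩ := exists_forall_mem_iff_mem_lineGraph_apply htri ψ hfe huf hue
      obtain ⟨x, hx⟩ := (hw e).1 hue
      have hwx : G.Adj w x := by have := (ψ e).2; rwa [hx, mem_edgeSet] at this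
      refine ⟨x, fun g => ⟨fun hg => ?_, fun hg => ?_⟩⟩
      · rw [hv g hg, hx]; simp
      · suffices g = e by rw [this]; exact hve
        by_contra hge
        have hxe : x ∈ (ψ e : Sym2 V) := by rw [hx]; simp
        obtain ⟨-, y, hyg, hye⟩ := lineGraph_adj_iff_exists.1 (ψ.map_adj_iff.1
          (lineGraph_adj_iff_exists.2 ⟨ψ.injective.ne hge, x, hg, hxe⟩))
        rw [heu, Sym2.mem_iff] at hye
        rcases hye with rfl | rfl
        · exact hge (hv g hyg)
        · have := (Sym2.mem_and_mem_iff hwx.ne).1 ⟨(hw g).1 hyg, hg⟩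
          exact hge (ψ.injective (Subtype.ext (this.trans hx.symm)))
    · push Not at hv
      obtain ⟨f, hvf, hfe⟩ := hv
      exact exists_forall_mem_iff_mem_lineGraph_apply htri ψ hfe hvf hve
  choose φ hφ using hex
  -- Distinct vertices with the same incident edges would span an isolated edge, the only edge by
  -- connectedness.
  have hinj : Function.Injective φ := by
    intro v v' h
    by_contra hne
    have hvv : ∀ g : G.edgeSet, v ∈ (g : Sym2 V) ↔ v' ∈ (g : Sym2 V) := fun g => by
      rw [hφ v, hφ v', h]
    obtain ⟨e, hve⟩ := hG.exists_edge_mem v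
    have he := (Sym2.mem_and_mem_iff hne).1 ⟨hve, (hvv e).1 hve⟩
    have hv : ∀ f : G.edgeSet, v ∈ (f : Sym2 V) → f = e := fun f hf =>
      Subtype.ext (((Sym2.mem_and_mem_iff hne).1 ⟨hf, (hvv f).1 hf⟩).trans he.symm)
    exact hnot e (hG.edgeSet_subsingleton_of_isolated he hv fun f hf => hv f ((hvv f).2 hf))
  have hadj : ∀ {u v}, G.Adj (φ u) (φ v) ↔ G.Adj u v := by
    intro u v
    constructor
    · intro h
      have hne : u ≠ v := fun h' => h.ne (congrArg φ h')
      have hmem : u ∈ (ψ.symm ⟨s(φ u, φ v), h⟩ : Sym2 V) ∧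
          v ∈ (ψ.symm ⟨s(φ u, φ v), h⟩ : Sym2 V) := by
        simp [hφ]
      have := (ψ.symm ⟨s(φ u, φ v), h⟩).2
      rwa [(Sym2.mem_and_mem_iff hne).1 hmem, mem_edgeSet] at this
    · intro h
      have := (Sym2.mem_and_mem_iff (hinj.ne h.ne)).1
        ⟨(hφ u ⟨s(u, v), h⟩).1 (by simp), (hφ v ⟨s(u, v), h⟩).1 (by simp)⟩
      have h2 := (ψ ⟨s(u, v), h⟩).2
      rwa [this, mem_edgeSet] at h2
  refine ⟨⟨Equiv.ofBijective φ (Finite.injective_iff_bijective.1 hinj), hadj⟩, ?_⟩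
  refine RelIso.ext fun ⟨e, h⟩ => Subtype.ext ?_
  obtain ⟨u, v⟩ := e
  exact ((Sym2.mem_and_mem_iff (hinj.ne (G.ne_of_adj h))).1
    ⟨(hφ u ⟨s(u, v), h⟩).1 (by simp), (hφ v ⟨s(u, v), h⟩).1 (by simp)⟩).symm

end Whitney

/-! ### Transfer of distinguishing colourings -/

section Distinguishing

variable {α : Type*} [Finite V]

/-- A distinguishing vertex colouring of a tree that is constant on the center gives a
distinguishing colouring of the line graph with the same colours: every edge receives the colour
of its endpoint of larger eccentricity. -/
lemma IsTree.exists_isDistinguishing_lineGraph [Nontrivial V] (hG : G.IsTree) {χ : V → α}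
    (hχ : G.IsDistinguishing χ) (hc : ∀ u ∈ G.center, ∀ w ∈ G.center, χ u = χ w) :
    ∃ g : G.edgeSet → α, G.lineGraph.IsDistinguishing g := by
  have hex : ∀ e : G.edgeSet, ∃ v ∈ (e : Sym2 V), ∀ u ∈ (e : Sym2 V),
      G.natEccent u ≤ G.natEccent v := by
    rintro ⟨⟨a, b⟩, -⟩
    rcases le_total (G.natEccent a) (G.natEccent b) with h | h
    · exact ⟨b, by simp, by simp [h]⟩
    · exact ⟨a, by simp, by simp [h]⟩
  choose t ht ht' using hex
  have key : ∀ {v w} (h : G.Adj v w), G.natEccent w < G.natEccent v → t ⟨s(v, w), h⟩ = v := by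
    intro v w h hlt
    have h1 := ht ⟨s(v, w), h⟩
    have h2 := ht' ⟨s(v, w), h⟩ v (by simp)
    rw [Sym2.mem_iff] at h1
    rcases h1 with h1 | h1
    · exact h1
    · rw [h1] at h2; omega
  refine ⟨fun e => χ (t e), fun ψ hψ => ?_⟩
  obtain ⟨φ, rfl⟩ := hG.connected.exists_iso_of_lineGraph_iso
    (fun _ _ _ => hG.not_adj_of_adj_of_adj) ψ
  by_contra! hcon
  refine hψ ?_
  suffices φ = Iso.refl by
    subst this
    exact RelIso.ext fun e => Subtype.ext (congrFun Sym2.map_id _)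
  by_contra hφ
  obtain ⟨v, hv⟩ := hχ φ hφ
  refine hv ?_
  by_cases hvc : v ∈ G.center
  · exact hc _ hvc _ ((φ.apply_mem_center_iff hG.connected).2 hvc)
  · obtain ⟨w, hw, hlt⟩ := hG.exists_adj_natEccent_lt hvc
    have h1 := hcon ⟨s(v, w), hw⟩
    have h2 : φ.lineGraph ⟨s(v, w), hw⟩ = ⟨s(φ v, φ w), φ.map_adj_iff.2 hw⟩ := rfl
    rwa [h2, key hw hlt, key _ (by simpa only [φ.natEccent_apply hG.connected])] at h1

/-- If some distinguishing colouring of a tree is constant on the center, then a distinguishing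
colouring of the line graph gives a distinguishing colouring of the tree with the same colours:
every noncentral vertex receives the colour of the edge leading towards the center. -/
lemma IsTree.exists_isDistinguishing_of_lineGraph [Nontrivial V] {β : Type*} (hG : G.IsTree)
    {χ : V → β} (hχ : G.IsDistinguishing χ) (hc : ∀ u ∈ G.center, ∀ w ∈ G.center, χ u = χ w)
    {g : G.edgeSet → α} (hg : G.lineGraph.IsDistinguishing g) :
    ∃ f : V → α, G.IsDistinguishing f := by
  classical
  have hex : ∀ v : {v // v ∉ G.center}, ∃ w, G.Adj v w ∧ G.natEccent w < G.natEccent v :=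
    fun v => hG.exists_adj_natEccent_lt v.2
  choose p hp hlt using hex
  have := hG.connected.nonempty
  obtain ⟨e₀, -⟩ := hG.connected.exists_edge_mem (Classical.arbitrary V)
  -- All central vertices share an arbitrary colour, that of `e₀`.
  refine ⟨fun v => if h : v ∉ G.center then g ⟨s(v, p ⟨v, h⟩), hp ⟨v, h⟩⟩ else g e₀,
    fun φ hφ => ?_⟩
  by_contra! hcon
  have hE := φ.natEccent_apply hG.connected
  have hC : ∀ v, φ v ∈ G.center ↔ v ∈ G.center :=
    fun v => φ.apply_mem_center_iff hG.connected
  have hpu : ∀ {v u} (h : v ∉ G.center), G.Adj v u → G.natEccent u ≤ G.natEccent v →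
      p ⟨v, h⟩ = u := fun h hvu hle =>
    hG.eq_of_adj_of_natEccent_le (hp ⟨_, h⟩) hvu (hlt ⟨_, h⟩).le hle
  have step : ∀ {v u} (h : G.Adj v u), G.natEccent u ≤ G.natEccent v →
      g ⟨s(v, u), h⟩ = g ⟨s(φ v, φ u), φ.map_adj_iff.2 h⟩ := by
    intro v u h hle
    by_cases hv : v ∈ G.center
    · have hu : u ∈ G.center := by
        rw [hG.connected.mem_center_iff_natEccent] at hv ⊢
        exact fun x => hle.trans (hv x)
      -- Both ends are central, so they make up the whole center and `φ` fixes the edge, possibly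
      -- swapping its ends.
      congr 2
      rcases hG.eq_or_eq_of_mem_center h hv hu ((hC v).2 hv) with h1 | h1 <;>
        rcases hG.eq_or_eq_of_mem_center h hv hu ((hC u).2 hu) with h2 | h2
      · exact absurd (φ.injective (h1.trans h2.symm)) h.ne
      · rw [h1, h2]
      · rw [h1, h2, Sym2.eq_swap]
      · exact absurd (φ.injective (h1.trans h2.symm)) h.ne
    · have hv' : φ v ∉ G.center := (hC v).not.2 hv
      have h1 := hcon v
      simp only [hv, hv', not_false_eq_true, dite_true] at h1
      have e1 := hpu hv h hle
      have e2 := hpu hv' (φ.map_adj_iff.2 h) (by rwa [hE, hE])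
      simpa only [e1, e2] using h1
  have hψ : φ.lineGraph = Iso.refl := by
    by_contra hne
    obtain ⟨⟨⟨u, v⟩, h⟩, hne'⟩ := hg _ hne
    refine hne' ?_
    rcases le_total (G.natEccent v) (G.natEccent u) with hle | hle
    · exact step h hle
    · have := step (G.adj_symm h) hle
      simp only [Sym2.eq_swap] at this
      exact this
  obtain ⟨x, hx⟩ := hχ φ hφ
  obtain ⟨⟨e, he⟩, u, rfl⟩ := hG.connected.exists_edge_mem x
  have h1 : s(φ x, φ u) = s(x, u) :=
    congrArg (fun ψ => (ψ ⟨s(x, u), he⟩ : Sym2 V)) hψ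
  rw [Sym2.eq_iff] at h1
  rcases h1 with ⟨h1, -⟩ | ⟨h1, -⟩
  · exact hx (by rw [h1])
  -- A swapped edge has ends of equal eccentricity, so both are central, where `χ` is constant.
  · have hxu : G.natEccent x = G.natEccent u := by rw [← h1, hE]
    rw [h1] at hx
    exact hx (hc _ (hG.mem_center_of_adj_of_natEccent_eq he hxu) _
      (hG.mem_center_of_adj_of_natEccent_eq (G.adj_symm he) hxu.symm))

end Distinguishing

end SimpleGraph

theorem mainTheorem3 {V : Type*} [Finite V] [Nontrivial V] (T : SimpleGraph V) (hT : T.IsTree)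
    (h : ∃ (k : ℕ) (χ : V → Fin k), T.IsOptimalDistinguishing χ ∧
      ∀ u ∈ T.center, ∀ w ∈ T.center, χ u = χ w) :
    T.distinguishingNumber = T.lineGraph.distinguishingNumber := by
  obtain ⟨k, χ, ⟨hχ, rfl⟩, hc⟩ := h
  have hL : T.distinguishingNumber ∈
      {k : ℕ | ∃ f : T.edgeSet → Fin k, T.lineGraph.IsDistinguishing f} :=
    hT.exists_isDistinguishing_lineGraph hχ hc
  refine le_antisymm ?_ (Nat.sInf_le hL)
  -- `hL` makes the set nonempty, so the infimum is attained and is not the default value 0 of an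
  -- empty set.
  obtain ⟨g, hg⟩ := Nat.sInf_mem ⟨_, hL⟩
  exact Nat.sInf_le (hT.exists_isDistinguishing_of_lineGraph hχ hc hg)
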